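/- Let $\mathbb D$ be the open unit disc of $\mathbb C$ and $\mathbb T=\partial\mathbb D$. Let $H^2$ be the Hardy space of all functions $f(z)=\sum_{n\ge 0}a_nz^n$ on $\mathbb D$ with $\|f\|_{H^2}^2=\sum_{n\ge 0}|a_n|^2<\infty$, which is a Hilbert space for this norm. Let $E\subset\mathbb T$ be a closed set of Lebesgue measure zero. Then there exists a function $\varphi$ in the disc algebra, that is, $\varphi$ is continuous on $\overline{\mathbb D}$ and holomorphic on $\mathbb D$, with $\varphi(\mathbb D)\subset\mathbb D$, such that the composition operator $C_\varphi f=f\circ\varphi$ is a Hilbert–Schmidt operator on $H^2$ (that is, it is a bounded operator from $H^2$ to $H^2$ and $\sum_i\|C_\varphi e_i\|_{H^2}^2<\infty$ for an orthonormal basis $(e_i)$ of $H^2$) and $$E_\varphi(1):=\{\zeta\in\mathbb T:\ |\varphi(\zeta)|\ge 1\}=E .$$ -/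

import Mathlib

open Complex MeasureTheory Metric Set
open scoped UnitDisc ENNReal

noncomputable section

/-- A function belongs to the disc algebra when it is holomorphic on the open unit disc and
continuous on the closed unit disc (values outside the closed disc are irrelevant). -/
def MemDiscAlgebra (φ : ℂ → ℂ) : Prop :=
  DifferentiableOn ℂ φ (ball 0 1) ∧ ContinuousOn φ (closedBall 0 1)

/-- The level set `{ζ ∈ 𝕋 : |φ(ζ)| ≥ s}`. -/
def levelSet (φ : ℂ → ℂ) (s : ℝ) : Set Circle :=
  {ζ : Circle | s ≤ ‖φ (ζ : ℂ)‖}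

/-- Lebesgue measure (arc length) of a subset of the unit circle: the measure of its set of
arguments in `(-π, π]`. -/
def arcLength (E : Set Circle) : ℝ≥0∞ :=
  volume {t : ℝ | t ∈ Ioc (-Real.pi) Real.pi ∧ Circle.exp t ∈ E}

/-- The power series `∑ aₙ zⁿ` with square summable coefficients converges on the disc. -/
theorem summable_hardy_series (a : lp (fun _ : ℕ => ℂ) 2) (z : 𝔻) :
    Summable fun n : ℕ => a n * (z : ℂ) ^ n := by
  refine Summable.of_norm_bounded
    (g := fun n : ℕ => ‖a‖ * ‖(z : ℂ)‖ ^ n)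
    ((summable_geometric_of_lt_one (norm_nonneg _) z.norm_lt_one).mul_left _) ?_
  intro n
  rw [norm_mul, norm_pow]
  exact mul_le_mul_of_nonneg_right (lp.norm_apply_le_norm (by norm_num) a n) (by positivity)

/-- The map `(aₙ) ↦ (z ↦ ∑ aₙ zⁿ)` from `ℓ²` to functions on the open unit disc. -/
def hardySeries : lp (fun _ : ℕ => ℂ) 2 →ₗ[ℂ] (𝔻 → ℂ) where
  toFun a z := ∑' n : ℕ, a n * (z : ℂ) ^ n
  map_add' a b := by
    funext z
    simp only [lp.coeFn_add, Pi.add_apply, add_mul]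
    exact (summable_hardy_series a z).tsum_add (summable_hardy_series b z)
  map_smul' c a := by
    funext z
    simp only [lp.coeFn_smul, Pi.smul_apply, smul_eq_mul, mul_assoc, RingHom.id_apply]
    exact tsum_mul_left

/-- A function on the disc determines its Taylor coefficients. -/
theorem hardySeries_injective : Function.Injective hardySeries := by
  rw [← LinearMap.ker_eq_bot, LinearMap.ker_eq_bot']
  intro a ha
  have hp : HasFPowerSeriesAt (fun _ : ℂ => (0 : ℂ))
      (FormalMultilinearSeries.ofScalars ℂ (fun n => a n)) 0 := by
    rw [hasFPowerSeriesAt_iff]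
    filter_upwards [ball_mem_nhds (0 : ℂ) one_pos] with z hz
    have hz' : ‖z‖ < 1 := by simpa using hz
    have h := (summable_hardy_series a (UnitDisc.mk z hz')).hasSum
    have h0 := congrFun ha (UnitDisc.mk z hz')
    simp only [hardySeries, LinearMap.coe_mk, AddHom.coe_mk, Pi.zero_apply] at h0
    rw [h0] at h
    simpa [FormalMultilinearSeries.coeff_ofScalars, mul_comm] using h
  have hz := hp.eq_zero
  ext n
  have h := congrArg (fun p => FormalMultilinearSeries.coeff p n) hz
  have h' : FormalMultilinearSeries.coeff (0 : FormalMultilinearSeries ℂ ℂ ℂ) n = 0 := rfl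
  simpa [FormalMultilinearSeries.coeff_ofScalars, h'] using h

/-- The Hardy space `H²` of the unit disc: all functions `f(z) = ∑ aₙ zⁿ` on the disc with
`∑ |aₙ|² < ∞`. (A separate type, since it does not carry the topology of pointwise convergence.) -/
def HardySpace : Type := ↥(LinearMap.range hardySeries)

namespace HardySpace

instance : AddCommGroup HardySpace := inferInstanceAs (AddCommGroup (LinearMap.range hardySeries))

instance : Module ℂ HardySpace := inferInstanceAs (Module ℂ (LinearMap.range hardySeries))

/-- Elements of `H²` are functions on the open unit disc. -/
instance : CoeFun HardySpace (fun _ => 𝔻 → ℂ) := ⟨Subtype.val⟩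

/-- The sequence of Taylor coefficients at `0` of a function in `H²`. -/
def coeffs : HardySpace ≃ₗ[ℂ] lp (fun _ : ℕ => ℂ) 2 :=
  (LinearEquiv.ofInjective hardySeries hardySeries_injective).symm

/-- Every `f ∈ H²` is the sum of its Taylor series. -/
theorem hasSum_coeffs (f : HardySpace) (z : 𝔻) :
    HasSum (fun n : ℕ => coeffs f n * (z : ℂ) ^ n) (f z) := by
  have h : hardySeries (coeffs f) = f.val :=
    congrArg Subtype.val
      ((LinearEquiv.ofInjective hardySeries hardySeries_injective).apply_symm_apply f)
  rw [← h]
  exact (summable_hardy_series (coeffs f) z).hasSum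

/-- The inner product `⟪f, g⟫ = ∑ conj(aₙ) bₙ` of `f = ∑ aₙ zⁿ` and `g = ∑ bₙ zⁿ`
(conjugate linear in the first variable, as everywhere in the library). -/
abbrev innerCore : InnerProductSpace.Core ℂ HardySpace where
  inner f g := inner ℂ (coeffs f) (coeffs g)
  conj_inner_symm f g := inner_conj_symm (coeffs f) (coeffs g)
  re_inner_nonneg f := inner_self_nonneg (𝕜 := ℂ) (x := coeffs f)
  add_left f g h := by rw [map_add]; exact inner_add_left _ _ _
  smul_left f g r := by rw [map_smul]; exact inner_smul_left _ _ _
  definite f hf := by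
    have h : coeffs f = 0 := inner_self_eq_zero.mp hf
    exact (LinearEquiv.map_eq_zero_iff coeffs).mp h

instance : NormedAddCommGroup HardySpace := innerCore.toNormedAddCommGroup

instance : InnerProductSpace ℂ HardySpace := InnerProductSpace.ofCore innerCore.toCore

theorem norm_coeffs (f : HardySpace) : ‖coeffs f‖ = ‖f‖ := by
  have h : inner ℂ (coeffs f) (coeffs f) = inner ℂ f f := rfl
  rw [inner_self_eq_norm_sq_to_K, inner_self_eq_norm_sq_to_K] at h
  exact (pow_left_inj₀ (norm_nonneg _) (norm_nonneg _) two_ne_zero).mp (by exact_mod_cast h)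

/-- Taking Taylor coefficients is an isometry of `H²` onto `ℓ²`. -/
def coeffsIsometry : HardySpace ≃ₗᵢ[ℂ] lp (fun _ : ℕ => ℂ) 2 := ⟨coeffs, norm_coeffs⟩

instance : CompleteSpace HardySpace :=
  coeffsIsometry.toIsometryEquiv.completeSpace

/-- The norm is `‖f‖² = ∑ |aₙ|²`. -/
theorem norm_sq_eq (f : HardySpace) : ‖f‖ ^ 2 = ∑' n : ℕ, ‖coeffs f n‖ ^ 2 := by
  rw [← norm_coeffs]
  simpa using lp.norm_rpow_eq_tsum (p := 2) (by norm_num) (coeffs f)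

end HardySpace

/-- A bounded operator on a Hilbert space is Hilbert–Schmidt when `∑ ‖T bᵢ‖² < ∞` for an
orthonormal basis `(bᵢ)`; the sum does not depend on the basis. -/
def IsHilbertSchmidt {H : Type} [NormedAddCommGroup H] [InnerProductSpace ℂ H]
    (T : H →L[ℂ] H) : Prop :=
  ∃ (ι : Type) (b : HilbertBasis ι ℂ H), Summable fun i => ‖T (b i)‖ ^ 2

/-- `T` is the composition operator `C_φ f = f ∘ φ` on `H²`, for a self-map `φ` of the disc. -/
def IsCompositionOperator (φ : ℂ → ℂ) (hφ : ∀ z : 𝔻, ‖φ (z : ℂ)‖ < 1)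
    (T : HardySpace →L[ℂ] HardySpace) : Prop :=
  ∀ (f : HardySpace) (z : 𝔻), T f z = f (UnitDisc.mk (φ (z : ℂ)) (hφ z))

end

/-!
Since `E` is null, it can be covered by balls `B(cᵢ, rᵢ)` with centres in `E` and `∑ rᵢ < ∞` in such
a way that every point of `E` lies in infinitely many of them. Then
`G z = 1 + ∑ rᵢ / (rᵢ + (1 - z / cᵢ))` is holomorphic on the disc and continuous on the closed disc
minus `E`, its real part is at least `1`, and `Re G → ∞` at every point of `E` because each ball
containing the point contributes at least `1 / 2`. The square root `F = √G` takes values in the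
sector `|Im F| ≤ Re F`, so that `φ = 1 - 1 / F`, extended by `1` on `E`, satisfies
`∑ |φ|²ⁿ = 1 / (1 - |φ|²) ≤ 2 Re F`. The right hand side is harmonic, so the mean value property
over circles of radius tending to `1` gives `∑ ‖φⁿ‖² ≤ 2 Re F(0)` in `H²`, and the `φⁿ` are the
images under `C_φ` of the orthonormal basis of monomials.
-/

open Filter Topology

section CircleAverage

open Real InnerProductSpace

variable {V : Type*} [NormedAddCommGroup V] [InnerProductSpace ℂ V] {g : ℂ → V} {c : ℂ} {R : ℝ}

theorem diffContOnCl_dslope [CompleteSpace V] (hR : R ≠ 0)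
    (hg : DiffContOnCl ℂ g (ball c |R|)) :
    DiffContOnCl ℂ (dslope g c) (ball c |R|) := by
  have hnhds : ball c |R| ∈ 𝓝 c := ball_mem_nhds c (abs_pos.2 hR)
  exact ⟨(differentiableOn_dslope hnhds).2 hg.1,
    (continuousOn_dslope (mem_of_superset hnhds subset_closure)).2
      ⟨hg.2, hg.1.differentiableAt hnhds⟩⟩

theorem circleIntegrable_norm_sq (hg : DiffContOnCl ℂ g (ball c |R|)) :
    CircleIntegrable (fun z => ‖g z‖ ^ 2) c R :=
  ((hg.continuousOn_ball.norm.pow 2).mono sphere_subset_closedBall).circleIntegrable'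

theorem circleAverage_re_inner_sub_smul_eq_zero (v : V) (hg : DiffContOnCl ℂ g (ball c |R|)) :
    circleAverage (fun z => (inner ℂ v ((z - c) • g z)).re) c R = 0 := by
  have hh : DiffContOnCl ℂ (fun z => inner ℂ v ((z - c) • g z)) (ball c |R|) :=
    (innerSL ℂ v).differentiable.comp_diffContOnCl
      ((differentiable_id.sub_const c).diffContOnCl.smul hg)
  have hint : CircleIntegrable (fun z => inner ℂ v ((z - c) • g z)) c R :=
    (hh.continuousOn_ball.mono sphere_subset_closedBall).circleIntegrable'
  calc circleAverage (fun z => (inner ℂ v ((z - c) • g z)).re) c R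
      = (circleAverage (fun z => inner ℂ v ((z - c) • g z)) c R).re :=
        reCLM.circleAverage_comp_comm hint
    _ = 0 := by rw [hh.circleAverage, sub_self, zero_smul, inner_zero_right, zero_re]

theorem circleAverage_norm_sq_eq_add_dslope [CompleteSpace V]
    (hg : DiffContOnCl ℂ g (ball c |R|)) :
    circleAverage (fun z => ‖g z‖ ^ 2) c R
      = ‖g c‖ ^ 2 + R ^ 2 * circleAverage (fun z => ‖dslope g c z‖ ^ 2) c R := by
  rcases eq_or_ne R 0 with rfl | hR
  · simp
  have hq := diffContOnCl_dslope hR hg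
  set q := dslope g c
  -- The cross term has mean zero: `⟪g c, (z - c) • q z⟫` is holomorphic and vanishes at `c`.
  have hexpand : EqOn (fun z => ‖g z‖ ^ 2) (fun z => ‖g c‖ ^ 2
      + ((2 : ℝ) • (inner ℂ (g c) ((z - c) • q z)).re + R ^ 2 • ‖q z‖ ^ 2)) (sphere c |R|) := by
    intro z hz
    have hgz : g z = g c + (z - c) • q z := by rw [sub_smul_dslope]; abel
    have hzR : ‖z - c‖ ^ 2 = R ^ 2 := by rw [mem_sphere_iff_norm.1 hz, sq_abs]
    simp only [hgz, norm_add_sq (𝕜 := ℂ), norm_smul, mul_pow, hzR, RCLike.re_to_complex,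
      smul_eq_mul, add_assoc]
  have hcross : CircleIntegrable (fun z => (2 : ℝ) • (inner ℂ (g c) ((z - c) • q z)).re) c R := by
    refine ContinuousOn.circleIntegrable' ?_
    have hqc := hq.continuousOn_ball.mono sphere_subset_closedBall
    fun_prop
  rw [circleAverage_congr_sphere hexpand,
    circleAverage_fun_add (circleIntegrable_const _ _ _)
      (hcross.fun_add (circleIntegrable_norm_sq hq).const_fun_smul),
    circleAverage_fun_add hcross (circleIntegrable_norm_sq hq).const_fun_smul,
    circleAverage_const, circleAverage_fun_smul, circleAverage_fun_smul,
    circleAverage_re_inner_sub_smul_eq_zero (g c) hq]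
  simp

theorem sum_norm_coeff_sq_mul_pow_le_circleAverage [CompleteSpace V] (N : ℕ)
    {p : FormalMultilinearSeries ℂ ℂ V} (hR : R ≠ 0)
    (hg : DiffContOnCl ℂ g (ball c |R|)) (hp : HasFPowerSeriesAt g p c) :
    ∑ n ∈ Finset.range N, ‖p.coeff n‖ ^ 2 * (R ^ 2) ^ n
      ≤ circleAverage (fun z => ‖g z‖ ^ 2) c R := by
  induction N generalizing g p with
  | zero => simpa using circleAverage_nonneg_of_nonneg fun z _ => sq_nonneg ‖g z‖
  | succ N ih =>
    have hq := ih (diffContOnCl_dslope hR hg) hp.has_fpower_series_dslope_fslope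
    simp only [FormalMultilinearSeries.coeff_fslope] at hq
    rw [Finset.sum_range_succ', circleAverage_norm_sq_eq_add_dslope hg]
    calc ∑ n ∈ Finset.range N, ‖p.coeff (n + 1)‖ ^ 2 * (R ^ 2) ^ (n + 1)
          + ‖p.coeff 0‖ ^ 2 * (R ^ 2) ^ 0
        = ‖g c‖ ^ 2 + R ^ 2 * ∑ n ∈ Finset.range N, ‖p.coeff (n + 1)‖ ^ 2 * (R ^ 2) ^ n := by
          rw [Finset.mul_sum, show p.coeff 0 = g c from hp.coeff_zero 1, add_comm, pow_zero,
            mul_one]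
          congr 1
          exact Finset.sum_congr rfl fun n _ => by ring
      _ ≤ _ := by gcongr

theorem sum_norm_coeff_sq_le_of_harmonicOnNhd [CompleteSpace V] {ι : Type*} (s : Finset ι)
    {f : ι → ℂ → V} {p : ι → FormalMultilinearSeries ℂ ℂ V} {u : ℂ → ℝ} (N : ℕ)
    (hf : ∀ i ∈ s, DifferentiableOn ℂ (f i) (ball c R))
    (hp : ∀ i ∈ s, HasFPowerSeriesAt (f i) (p i) c) (hR : 0 < R)
    (hu : HarmonicOnNhd u (ball c R)) (hfu : ∀ z ∈ ball c R, ∑ i ∈ s, ‖f i z‖ ^ 2 ≤ u z) :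
    ∑ i ∈ s, ∑ n ∈ Finset.range N, ‖(p i).coeff n‖ ^ 2 * (R ^ 2) ^ n ≤ u c := by
  have hsmall : ∀ r ∈ Ioo 0 R,
      ∑ i ∈ s, ∑ n ∈ Finset.range N, ‖(p i).coeff n‖ ^ 2 * (r ^ 2) ^ n ≤ u c := by
    intro r hr
    have hball : closedBall c |r| ⊆ ball c R := by
      rw [abs_of_pos hr.1]
      exact closedBall_subset_ball hr.2
    have hfr : ∀ i ∈ s, DiffContOnCl ℂ (f i) (ball c |r|) := fun i hi =>
      ((hf i hi).mono (closure_ball_subset_closedBall.trans hball)).diffContOnCl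
    calc _ ≤ ∑ i ∈ s, circleAverage (fun z => ‖f i z‖ ^ 2) c r := Finset.sum_le_sum fun i hi =>
          sum_norm_coeff_sq_mul_pow_le_circleAverage N hr.1.ne' (hfr i hi) (hp i hi)
      _ = circleAverage (fun z => ∑ i ∈ s, ‖f i z‖ ^ 2) c r :=
          (circleAverage_fun_sum fun i hi => circleIntegrable_norm_sq (hfr i hi)).symm
      _ ≤ circleAverage u c r := circleAverage_mono
          (CircleIntegrable.fun_sum s fun i hi => circleIntegrable_norm_sq (hfr i hi))
          ((hu.mono hball).continuousOn.mono sphere_subset_closedBall).circleIntegrable'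
          fun z hz => hfu z (hball (sphere_subset_closedBall hz))
      _ = u c := (hu.mono hball).circleAverage_eq
  have hlim : Tendsto (fun r : ℝ => ∑ i ∈ s, ∑ n ∈ Finset.range N,
      ‖(p i).coeff n‖ ^ 2 * (r ^ 2) ^ n) (𝓝[<] R)
      (𝓝 (∑ i ∈ s, ∑ n ∈ Finset.range N, ‖(p i).coeff n‖ ^ 2 * (R ^ 2) ^ n)) :=
    Continuous.tendsto (by fun_prop) R |>.mono_left nhdsWithin_le_nhds
  exact le_of_tendsto hlim (mem_of_superset (Ioo_mem_nhdsLT hR) hsmall)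

end CircleAverage

theorem exists_continuousLinearMap_hasSum_repr_smul {ι 𝕜 H F : Type*} [RCLike 𝕜]
    [NormedAddCommGroup H] [InnerProductSpace 𝕜 H] [NormedAddCommGroup F] [NormedSpace 𝕜 F]
    [CompleteSpace F] (b : HilbertBasis ι 𝕜 H) {e : ι → F} (he : Summable fun i => ‖e i‖ ^ 2) :
    ∃ T : H →L[𝕜] F, ∀ x, HasSum (fun i => b.repr x i • e i) (T x) := by
  have hcs : ∀ x, Summable (fun i => ‖b.repr x i • e i‖) ∧
      ∑' i, ‖b.repr x i • e i‖ ≤ ‖x‖ * (∑' i, ‖e i‖ ^ 2) ^ (1 / 2 : ℝ) := by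
    intro x
    have hx : ‖x‖ = (∑' i, ‖b.repr x i‖ ^ (2 : ℝ)) ^ (1 / 2 : ℝ) := by
      rw [← b.repr.norm_map, lp.norm_eq_tsum_rpow (by norm_num)]
      simp
    have hmem := (lp.memℓp (b.repr x)).summable (by norm_num)
    simpa only [norm_smul, hx, Real.rpow_two] using
      Real.summable_and_inner_le_Lp_mul_Lq_tsum_of_nonneg Real.HolderConjugate.two_two
        (fun i => norm_nonneg (b.repr x i)) (fun i => norm_nonneg (e i))
        (by simpa using hmem) (by simpa using he)
  have hsum : ∀ x, HasSum (fun i => b.repr x i • e i) (∑' i, b.repr x i • e i) := fun x =>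
    (hcs x).1.of_norm.hasSum
  let T : H →ₗ[𝕜] F :=
    { toFun x := ∑' i, b.repr x i • e i
      map_add' x y := by
        simpa [add_smul] using (hsum x).summable.tsum_add (hsum y).summable
      map_smul' k x := by
        simpa [mul_smul] using (hsum x).summable.tsum_const_smul k }
  refine ⟨T.mkContinuous ((∑' i, ‖e i‖ ^ 2) ^ (1 / 2 : ℝ)) fun x => ?_, hsum⟩
  rw [mul_comm]
  exact (norm_tsum_le_tsum_norm (hcs x).1).trans (hcs x).2

namespace HardySpace

/-- The monomials `zⁿ`, as an orthonormal basis of `H²`. -/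
noncomputable def monomialBasis : HilbertBasis ℕ ℂ HardySpace := .ofRepr coeffsIsometry

theorem monomialBasis_repr (f : HardySpace) (n : ℕ) : monomialBasis.repr f n = coeffs f n := rfl

theorem exists_of_hasSum {a : ℕ → ℂ} {g : ℂ → ℂ} (ha : Summable fun n => ‖a n‖ ^ 2)
    (hg : ∀ z ∈ ball (0 : ℂ) 1, HasSum (fun n => a n * z ^ n) (g z)) :
    ∃ f : HardySpace, (∀ z : 𝔻, f z = g z) ∧ ∀ n, coeffs f n = a n := by
  have hmem : Memℓp a 2 := memℓp_gen (by simpa using ha)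
  have hcoeffs : ∀ n, coeffs (coeffs.symm ⟨a, hmem⟩) n = a n := fun n =>
    congrArg (fun x : lp (fun _ : ℕ => ℂ) 2 => x n) (coeffs.apply_symm_apply ⟨a, hmem⟩)
  refine ⟨coeffs.symm ⟨a, hmem⟩, fun z => ?_, hcoeffs⟩
  have hsum := hasSum_coeffs (coeffs.symm ⟨a, hmem⟩) z
  simp only [hcoeffs] at hsum
  exact hsum.unique (hg z (by simpa using z.norm_lt_one))

theorem exists_evalCLM (z : 𝔻) : ∃ δ : HardySpace →L[ℂ] ℂ, ∀ f, δ f = f z := by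
  have hgeom : Summable fun n => ‖(z : ℂ) ^ n‖ ^ 2 := by
    have hpow : ∀ n, ‖(z : ℂ) ^ n‖ ^ 2 = (‖(z : ℂ)‖ ^ 2) ^ n := fun n => by
      rw [norm_pow, pow_right_comm]
    simp only [hpow]
    exact summable_geometric_of_lt_one (by positivity)
      (pow_lt_one₀ (norm_nonneg _) z.norm_lt_one two_ne_zero)
  obtain ⟨δ, hδ⟩ := exists_continuousLinearMap_hasSum_repr_smul monomialBasis hgeom
  exact ⟨δ, fun f => (hδ f).unique (hasSum_coeffs f z)⟩

theorem exists_summable_norm_sq_of_harmonic_majorant {ι : Type*} {f : ι → ℂ → ℂ} {u : ℂ → ℝ}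
    (hf : ∀ i, DifferentiableOn ℂ (f i) (ball 0 1))
    (hu : InnerProductSpace.HarmonicOnNhd u (ball 0 1))
    (hfu : ∀ s : Finset ι, ∀ z ∈ ball 0 1, ∑ i ∈ s, ‖f i z‖ ^ 2 ≤ u z) :
    ∃ e : ι → HardySpace, (∀ i, ∀ z : 𝔻, e i z = f i z) ∧ Summable fun i => ‖e i‖ ^ 2 := by
  let a : ι → ℕ → ℂ := fun i n => iteratedDeriv n (f i) 0 / n.factorial
  have hbound : ∀ (s : Finset ι) (N : ℕ),
      ∑ i ∈ s, ∑ n ∈ Finset.range N, ‖a i n‖ ^ 2 ≤ u 0 := by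
    intro s N
    have hp : ∀ i, HasFPowerSeriesAt (f i) (.ofScalars ℂ (a i)) 0 := fun i =>
      ((hf i).analyticAt (ball_mem_nhds 0 one_pos)).hasFPowerSeriesAt
    simpa [FormalMultilinearSeries.coeff_ofScalars] using sum_norm_coeff_sq_le_of_harmonicOnNhd s N
      (fun i _ => hf i) (fun i _ => hp i) one_pos hu (hfu s)
  have ha : ∀ i, Summable fun n => ‖a i n‖ ^ 2 := fun i =>
    summable_of_sum_range_le (fun n => by positivity) fun N => by simpa using hbound {i} N
  have htaylor : ∀ i, ∀ z ∈ ball (0 : ℂ) 1, HasSum (fun n => a i n * z ^ n) (f i z) := by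
    intro i z hz
    convert! hasSum_taylorSeries_on_ball (hf i) hz using 2 with n
    rw [sub_zero, smul_eq_mul, smul_eq_mul]
    ring
  choose e he hcoeffs using fun i => exists_of_hasSum (ha i) (htaylor i)
  refine ⟨e, he, summable_of_sum_le (c := u 0) (fun i => by positivity) fun s => ?_⟩
  simp only [norm_sq_eq, hcoeffs]
  exact le_of_tendsto' (tendsto_finsetSum s fun i _ => (ha i).hasSum.tendsto_sum_nat) (hbound s)

end HardySpace

theorem exists_isHilbertSchmidt_compositionOperator {φ : ℂ → ℂ} {u : ℂ → ℝ}
    (hφ : DifferentiableOn ℂ φ (ball 0 1)) (hφ1 : ∀ z : 𝔻, ‖φ z‖ < 1)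
    (hu : InnerProductSpace.HarmonicOnNhd u (ball 0 1))
    (hφu : ∀ z ∈ ball 0 1, (1 - ‖φ z‖ ^ 2)⁻¹ ≤ u z) :
    ∃ T : HardySpace →L[ℂ] HardySpace, IsCompositionOperator φ hφ1 T ∧ IsHilbertSchmidt T := by
  have hgeom : ∀ s : Finset ℕ, ∀ z ∈ ball 0 1, ∑ n ∈ s, ‖φ z ^ n‖ ^ 2 ≤ u z := by
    intro s z hz
    have hz1 : ‖φ z‖ ^ 2 < 1 :=
      pow_lt_one₀ (norm_nonneg _) (hφ1 (UnitDisc.mk z (by simpa using hz))) two_ne_zero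
    calc ∑ n ∈ s, ‖φ z ^ n‖ ^ 2 = ∑ n ∈ s, (‖φ z‖ ^ 2) ^ n := by
          simp only [norm_pow, pow_right_comm]
      _ ≤ (1 - ‖φ z‖ ^ 2)⁻¹ :=
        sum_le_hasSum s (fun n _ => by positivity) (hasSum_geometric_of_lt_one (by positivity) hz1)
      _ ≤ u z := hφu z hz
  obtain ⟨e, he, hsum⟩ := HardySpace.exists_summable_norm_sq_of_harmonic_majorant
    (fun n => hφ.pow n) hu hgeom
  obtain ⟨T, hT⟩ := exists_continuousLinearMap_hasSum_repr_smul HardySpace.monomialBasis hsum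
  refine ⟨T, fun f z => ?_, ℕ, HardySpace.monomialBasis, ?_⟩
  · obtain ⟨δ, hδ⟩ := HardySpace.exists_evalCLM z
    have hTz := (hT f).mapL δ
    simp only [map_smul] at hTz
    simp only [hδ, he, smul_eq_mul, HardySpace.monomialBasis_repr] at hTz
    exact hTz.unique (HardySpace.hasSum_coeffs f (UnitDisc.mk (φ z) (hφ1 z)))
  · have hTe : ∀ n, T (HardySpace.monomialBasis n) = e n := fun n => by
      refine (hT _).unique ?_
      convert hasSum_single n fun m hm => ?_ <;> simp [HilbertBasis.repr_self, *]
    simpa only [hTe] using hsum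

theorem exists_infinite_closedBall_covering.{v} {α : Type v} [MetricSpace α]
    [SecondCountableTopology α] [MeasurableSpace α] [OpensMeasurableSpace α]
    [HasBesicovitchCovering α] (μ : Measure α) [SFinite μ] [μ.OuterRegular] {s : Set α}
    (hs : μ s = 0) :
    ∃ (ι : Type v) (c : ι → α) (r : ι → ℝ), (∀ i, c i ∈ s) ∧ (∀ i, 0 < r i) ∧
      ∑' i, μ (closedBall (c i) (r i)) ≠ ∞ ∧
      ∀ x ∈ s, {i | x ∈ closedBall (c i) (r i)}.Infinite := by
  have hcover : ∀ k : ℕ, ∃ (t : Set α) (r : α → ℝ), t ⊆ s ∧ (∀ x ∈ t, 0 < r x) ∧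
      (s ⊆ ⋃ x ∈ t, closedBall x (r x)) ∧
      ∑' x : t, μ (closedBall x (r x)) ≤ (2⁻¹ : ℝ≥0∞) ^ k := by
    intro k
    obtain ⟨t, r, -, hts, hr, hst, hμ⟩ := Besicovitch.exists_closedBall_covering_tsum_measure_le μ
      (ε := 2⁻¹ ^ k) (by simp) (fun _ => Ioi 0) s
      fun x _ δ hδ => ⟨δ / 2, half_pos hδ, half_pos hδ, half_lt_self hδ⟩
    exact ⟨t, r, hts, hr, hst, by simpa [hs] using hμ⟩
  choose t r hts hr hst hμ using hcover
  refine ⟨Σ k, t k, fun i => i.2, fun i => r i.1 i.2, fun i => hts i.1 i.2.2,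
    fun i => hr i.1 i.2 i.2.2, ?_, fun x hx => ?_⟩
  · rw [ENNReal.tsum_sigma']
    refine ne_top_of_le_ne_top ?_ (ENNReal.tsum_le_tsum hμ)
    simp [ENNReal.tsum_geometric]
  · have hmem : ∀ k, ∃ y : t k, x ∈ closedBall (y : α) (r k y) := fun k => by
      simpa using hst k hx
    choose y hy using hmem
    exact infinite_of_injective_forall_mem (f := fun k => (⟨k, y k⟩ : Σ k, t k))
      (fun k l h => congrArg Sigma.fst h) hy

theorem dist_circleExp_le (s t : ℝ) : dist (Circle.exp s) (Circle.exp t) ≤ dist s t := by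
  have hfactor : (Circle.exp s : ℂ) - Circle.exp t
      = Circle.exp t * (Complex.exp (I * ((s - t : ℝ) : ℂ)) - 1) := by
    rw [mul_sub, mul_one, Circle.coe_exp, Circle.coe_exp, ← Complex.exp_add]
    push_cast
    ring_nf
  calc dist (Circle.exp s) (Circle.exp t) = ‖(Circle.exp s : ℂ) - Circle.exp t‖ :=
        Complex.dist_eq _ _
    _ = ‖Complex.exp (I * ((s - t : ℝ) : ℂ)) - 1‖ := by
        rw [hfactor, norm_mul, Circle.norm_coe, one_mul]
    _ ≤ dist s t := Real.norm_exp_I_mul_ofReal_sub_one_le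

theorem exists_summable_infinite_covering_of_arcLength_eq_zero {E : Set Circle}
    (hE : arcLength E = 0) :
    ∃ (ι : Type) (c : ι → Circle) (r : ι → ℝ), (∀ i, c i ∈ E) ∧ (∀ i, 0 < r i) ∧ Summable r ∧
      ∀ ζ ∈ E, {i | ζ ∈ closedBall (c i) (r i)}.Infinite := by
  obtain ⟨ι, τ, r, hτ, hr, hsum, hinf⟩ := exists_infinite_closedBall_covering volume hE
  refine ⟨ι, fun i => Circle.exp (τ i), r, fun i => (hτ i).2, hr, ?_, fun ζ hζ => ?_⟩
  · have hvol : ∑' i, ENNReal.ofReal (2 * r i) ≠ ∞ := by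
      simpa only [Real.volume_closedBall] using hsum
    have htoReal := ENNReal.summable_toReal hvol
    simp only [ENNReal.toReal_ofReal, (hr _).le, mul_nonneg, zero_le_two] at htoReal
    exact (summable_mul_left_iff two_ne_zero).1 htoReal
  · have harg : Circle.exp (arg ζ) = ζ := Circle.exp_arg ζ
    refine (hinf (arg ζ) ⟨arg_mem_Ioc ζ, harg.symm ▸ hζ⟩).mono fun i hi => ?_
    rw [mem_ofPred_eq, ← harg]
    exact (dist_circleExp_le _ _).trans hi

section HalfPlane

variable {r : ℝ} {w : ℂ}

theorem re_div_add_nonneg (hr : 0 ≤ r) (hw : 0 ≤ w.re) : 0 ≤ (r / (r + w)).re := by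
  rw [div_eq_mul_inv, re_ofReal_mul, inv_re]
  exact mul_nonneg hr (div_nonneg (by simpa using add_nonneg hr hw) (normSq_nonneg _))

theorem half_le_re_div_add (hr : 0 < r) (hw : 0 ≤ w.re) (hwr : ‖w‖ ≤ r) :
    1 / 2 ≤ (r / (r + w)).re := by
  have hne : r + w ≠ 0 := fun h => by
    have hre := congrArg re h
    simp only [add_re, ofReal_re, zero_re] at hre
    linarith
  have hsq : w.re ^ 2 + w.im ^ 2 ≤ r ^ 2 := by
    rw [sq w.re, sq w.im, ← normSq_apply, ← Complex.sq_norm]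
    gcongr
  rw [div_eq_mul_inv (r : ℂ), re_ofReal_mul, inv_re, ← mul_div_assoc,
    le_div_iff₀ (normSq_pos.2 hne)]
  simp only [normSq_apply, add_re, ofReal_re, add_im, ofReal_im]
  linarith

theorem norm_div_add_le (hr : 0 ≤ r) (hw : 0 ≤ w.re) (hw0 : w ≠ 0) : ‖r / (r + w)‖ ≤ r / ‖w‖ := by
  have hle : ‖w‖ ≤ ‖r + w‖ := by
    rw [← sq_le_sq₀ (norm_nonneg _) (norm_nonneg _), Complex.sq_norm, Complex.sq_norm,
      normSq_apply, normSq_apply]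
    simp only [add_re, ofReal_re, add_im, ofReal_im]
    nlinarith
  rw [norm_div, Complex.norm_of_nonneg hr]
  gcongr

end HalfPlane

theorem norm_one_sub_div_of_norm_eq_one {c : ℂ} (hc : ‖c‖ = 1) (z : ℂ) :
    ‖1 - z / c‖ = dist z c := by
  have hc0 : c ≠ 0 := norm_ne_zero_iff.1 (hc ▸ one_ne_zero)
  rw [dist_comm, Complex.dist_eq, ← div_self hc0, ← sub_div, norm_div, hc, div_one]

theorem re_one_sub_div_nonneg {c z : ℂ} (hzc : ‖z‖ ≤ ‖c‖) : 0 ≤ (1 - z / c).re := by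
  have hle : (z / c).re ≤ 1 :=
    (re_le_norm _).trans ((norm_div z c).trans_le (div_le_one_of_le₀ hzc (norm_nonneg c)))
  simpa using hle

/-- A holomorphic bump of width `r` at the point `c` of the unit circle: on the closed disc its real
part is nonnegative, and at least `1 / 2` within distance `r` of `c`. -/
noncomputable def cauchyBump (c : ℂ) (r : ℝ) (z : ℂ) : ℂ := r / (r + (1 - z / c))

/-- The sum of a family of bumps, normalized to have real part at least `1` on the disc. -/
noncomputable def bumpSeries {ι : Type*} (c : ι → ℂ) (r : ι → ℝ) (z : ℂ) : ℂ :=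
  1 + ∑' i, cauchyBump (c i) (r i) z

theorem differentiableAt_cauchyBump {c z : ℂ} {r : ℝ} (hr : 0 < r) (hzc : ‖z‖ ≤ ‖c‖) :
    DifferentiableAt ℂ (cauchyBump c r) z := by
  have hne : r + (1 - z / c) ≠ 0 := fun h => by
    have hre := congrArg re h
    rw [add_re, ofReal_re, zero_re] at hre
    linarith [re_one_sub_div_nonneg hzc]
  unfold cauchyBump
  fun_prop (disch := assumption)

section BumpSeries

variable {ι : Type*} {c : ι → ℂ} {r : ι → ℝ} {z : ℂ}

theorem exists_ball_norm_cauchyBump_le (hc : ∀ i, ‖c i‖ = 1) (hr : ∀ i, 0 < r i)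
    (hz : z ∉ closure (range c)) :
    ∃ δ > 0, ∀ w ∈ ball z δ ∩ closedBall 0 1, ∀ i, ‖cauchyBump (c i) (r i) w‖ ≤ r i / δ := by
  simp only [mem_closure_range_iff, not_forall, not_exists, not_lt] at hz
  obtain ⟨ε, hε, hzε⟩ := hz
  refine ⟨ε / 2, half_pos hε, fun w hw i => ?_⟩
  have hdist : ε / 2 ≤ ‖1 - w / c i‖ := by
    have hzw := mem_ball.1 hw.1
    have hzc := hzε i
    rw [norm_one_sub_div_of_norm_eq_one (hc i)]
    linarith [dist_triangle_left z (c i) w]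
  calc ‖cauchyBump (c i) (r i) w‖ ≤ r i / ‖1 - w / c i‖ :=
        norm_div_add_le (hr i).le (re_one_sub_div_nonneg (by simpa [hc i] using hw.2))
          (norm_pos_iff.1 ((half_pos hε).trans_le hdist))
    _ ≤ r i / (ε / 2) := div_le_div_of_nonneg_left (hr i).le (half_pos hε) hdist

theorem summable_cauchyBump (hc : ∀ i, ‖c i‖ = 1) (hr : ∀ i, 0 < r i) (hsum : Summable r)
    (hz : z ∈ closedBall 0 1 \ closure (range c)) :
    Summable fun i => cauchyBump (c i) (r i) z := by
  obtain ⟨δ, hδ, hbound⟩ := exists_ball_norm_cauchyBump_le hc hr hz.2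
  exact (hsum.div_const δ).of_norm_bounded (hbound z ⟨mem_ball_self hδ, hz.1⟩)

theorem one_add_sum_re_cauchyBump_le_re_bumpSeries (hc : ∀ i, ‖c i‖ = 1) (hr : ∀ i, 0 < r i)
    (hsum : Summable r) (hz : z ∈ closedBall 0 1 \ closure (range c)) (s : Finset ι) :
    1 + ∑ i ∈ s, (cauchyBump (c i) (r i) z).re ≤ (bumpSeries c r z).re := by
  have hre := hasSum_re (summable_cauchyBump hc hr hsum hz).hasSum
  rw [bumpSeries, add_re, one_re]
  gcongr
  exact sum_le_hasSum s (fun i _ => re_div_add_nonneg (hr i).le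
    (re_one_sub_div_nonneg (by simpa [hc i] using hz.1))) hre

theorem continuousOn_bumpSeries (hc : ∀ i, ‖c i‖ = 1) (hr : ∀ i, 0 < r i) (hsum : Summable r) :
    ContinuousOn (bumpSeries c r) (closedBall 0 1 \ closure (range c)) := by
  intro z hz
  obtain ⟨δ, hδ, hbound⟩ := exists_ball_norm_cauchyBump_le hc hr hz.2
  have hcont : ContinuousOn (bumpSeries c r) (ball z δ ∩ closedBall 0 1) :=
    continuousOn_const.add <| continuousOn_tsum
      (fun i w hw => (differentiableAt_cauchyBump (hr i)
        (by simpa [hc i] using hw.2)).continuousAt.continuousWithinAt)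
      (hsum.div_const δ) fun i w hw => hbound w hw i
  refine (hcont z ⟨mem_ball_self hδ, hz.1⟩).mono_of_mem_nhdsWithin ?_
  filter_upwards [self_mem_nhdsWithin, mem_nhdsWithin_of_mem_nhds (ball_mem_nhds z hδ)]
    with w hw hwδ using ⟨hwδ, hw.1⟩

theorem differentiableOn_bumpSeries (hc : ∀ i, ‖c i‖ = 1) (hr : ∀ i, 0 < r i) (hsum : Summable r) :
    DifferentiableOn ℂ (bumpSeries c r) (ball 0 1) := by
  intro z hz
  have hzc : z ∉ closure (range c) := fun h => by
    have hrange : range c ⊆ sphere 0 1 := range_subset_iff.2 fun i => by simpa using hc i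
    exact (mem_ball.1 hz).ne (closure_minimal hrange isClosed_sphere h)
  obtain ⟨δ, hδ, hbound⟩ := exists_ball_norm_cauchyBump_le hc hr hzc
  have hdiff : DifferentiableOn ℂ (bumpSeries c r) (ball z δ ∩ ball 0 1) :=
    (differentiableOn_tsum_of_summable_norm (hsum.div_const δ)
      (fun i w hw => (differentiableAt_cauchyBump (hr i)
        (by simpa [hc i] using (mem_ball.1 hw.2).le)).differentiableWithinAt)
      (isOpen_ball.inter isOpen_ball)
      fun i w hw => hbound w ⟨hw.1, ball_subset_closedBall hw.2⟩ i).const_add 1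
  exact (hdiff.differentiableAt ((isOpen_ball.inter isOpen_ball).mem_nhds
    ⟨mem_ball_self hδ, hz⟩)).differentiableWithinAt

theorem tendsto_re_bumpSeries_atTop (hc : ∀ i, ‖c i‖ = 1) (hr : ∀ i, 0 < r i)
    (hsum : Summable r) (hz : ‖z‖ ≤ 1) (hinf : {i | dist z (c i) ≤ r i}.Infinite) :
    Tendsto (fun w => (bumpSeries c r w).re)
      (𝓝[closedBall 0 1 \ closure (range c)] z) atTop := by
  rw [Filter.tendsto_atTop]
  intro M
  obtain ⟨N, hN⟩ := exists_nat_ge (2 * M)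
  obtain ⟨s, hs, hcard⟩ := hinf.exists_subset_card_eq N
  have hsum_z : M < 1 + ∑ i ∈ s, (cauchyBump (c i) (r i) z).re := by
    have hhalf : ∑ _i ∈ s, (1 / 2 : ℝ) ≤ ∑ i ∈ s, (cauchyBump (c i) (r i) z).re :=
      Finset.sum_le_sum fun i hi => half_le_re_div_add (hr i)
        (re_one_sub_div_nonneg (hz.trans_eq (hc i).symm))
        ((norm_one_sub_div_of_norm_eq_one (hc i) _).trans_le (hs hi))
    rw [Finset.sum_const, hcard, nsmul_eq_mul] at hhalf
    linarith
  have hcont : ContinuousAt (fun w => 1 + ∑ i ∈ s, (cauchyBump (c i) (r i) w).re) z := by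
    have hbump : ∀ i, ContinuousAt (cauchyBump (c i) (r i)) z := fun i =>
      (differentiableAt_cauchyBump (hr i) (hz.trans_eq (hc i).symm)).continuousAt
    fun_prop
  filter_upwards [mem_nhdsWithin_of_mem_nhds (hcont.eventually_const_lt hsum_z),
    self_mem_nhdsWithin] with w hMw hw
  exact hMw.le.trans (one_add_sum_re_cauchyBump_le_re_bumpSeries hc hr hsum hw s)

end BumpSeries

section SquareRoot

variable {s : ℂ}

theorem one_sub_norm_one_sub_inv_sq (hs : s ≠ 0) :
    1 - ‖1 - s⁻¹‖ ^ 2 = (2 * s.re - 1) / ‖s‖ ^ 2 := by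
  have hfrac : 1 - s⁻¹ = (s - 1) / s := by field_simp
  rw [hfrac, norm_div, div_pow, eq_div_iff (by simpa using hs), sub_mul,
    div_mul_cancel₀ _ (by simpa using hs), Complex.sq_norm, Complex.sq_norm, normSq_apply,
    normSq_apply]
  simp only [sub_re, sub_im, one_re, one_im]
  ring

theorem one_le_re_of_one_le_re_sq (hs : 0 ≤ s.re) (hsq : 1 ≤ (s ^ 2).re) : 1 ≤ s.re := by
  rw [sq, mul_re] at hsq
  nlinarith [mul_self_nonneg s.im]

theorem norm_one_sub_inv_lt_one (hs : 1 ≤ s.re) : ‖1 - s⁻¹‖ < 1 := by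
  have hs0 : s ≠ 0 := fun h => by norm_num [h] at hs
  have hpos : 0 < 1 - ‖1 - s⁻¹‖ ^ 2 := by
    rw [one_sub_norm_one_sub_inv_sq hs0]
    exact div_pos (by linarith) (by positivity)
  exact (sq_lt_one_iff₀ (norm_nonneg _)).1 (sub_pos.1 hpos)

theorem inv_one_sub_norm_one_sub_inv_sq_le (hs : 1 ≤ s.re) (hsq : 1 ≤ (s ^ 2).re) :
    (1 - ‖1 - s⁻¹‖ ^ 2)⁻¹ ≤ 2 * s.re := by
  have hs0 : s ≠ 0 := fun h => by norm_num [h] at hs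
  rw [sq, mul_re] at hsq
  rw [one_sub_norm_one_sub_inv_sq hs0, inv_div, div_le_iff₀ (by linarith), Complex.sq_norm,
    normSq_apply]
  nlinarith

end SquareRoot

theorem exists_re_tendsto_atTop_of_arcLength_eq_zero {E : Set Circle} (hE : IsClosed E)
    (hE0 : arcLength E = 0) :
    ∃ G : ℂ → ℂ, DifferentiableOn ℂ G (ball 0 1) ∧
      ContinuousOn G (closedBall 0 1 \ (↑) '' E) ∧
      (∀ z ∈ closedBall 0 1 \ (↑) '' E, 1 ≤ (G z).re) ∧
      ∀ z ∈ ((↑) : Circle → ℂ) '' E,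
        Tendsto (fun w => (G w).re) (𝓝[closedBall 0 1 \ (↑) '' E] z) atTop := by
  obtain ⟨ι, c, r, hcE, hr, hsum, hinf⟩ :=
    exists_summable_infinite_covering_of_arcLength_eq_zero hE0
  let c' : ι → ℂ := fun i => c i
  have hc : ∀ i, ‖c' i‖ = 1 := fun i => (c i).norm_coe
  have hcoe : Continuous ((↑) : Circle → ℂ) := continuous_subtype_val
  have hclosed : IsClosed (((↑) : Circle → ℂ) '' E) := (hE.isCompact.image hcoe).isClosed
  have hsub : closedBall (0 : ℂ) 1 \ (↑) '' E ⊆ closedBall 0 1 \ closure (range c') :=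
    Set.sdiff_subset_sdiff_right (closure_minimal
      (range_subset_iff.2 fun i => mem_image_of_mem _ (hcE i)) hclosed)
  refine ⟨bumpSeries c' r, differentiableOn_bumpSeries hc hr hsum,
    (continuousOn_bumpSeries hc hr hsum).mono hsub, fun z hz => ?_, ?_⟩
  · simpa using one_add_sum_re_cauchyBump_le_re_bumpSeries hc hr hsum (hsub hz) ∅
  · rintro _ ⟨ζ, hζ, rfl⟩
    exact (tendsto_re_bumpSeries_atTop hc hr hsum (Circle.norm_coe ζ).le (hinf ζ hζ)).mono_left
      (nhdsWithin_mono _ hsub)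

section Peak

variable {S : Set ℂ}

theorem ball_subset_closedBall_diff (hS : S ⊆ sphere 0 1) :
    ball (0 : ℂ) 1 ⊆ closedBall 0 1 \ S := fun _ hz =>
  ⟨ball_subset_closedBall hz, fun h => (mem_ball.1 hz).ne (hS h)⟩

theorem exists_sqrt_tendsto_cobounded {G : ℂ → ℂ} (hS : S ⊆ sphere 0 1)
    (hGd : DifferentiableOn ℂ G (ball 0 1)) (hGc : ContinuousOn G (closedBall 0 1 \ S))
    (hG1 : ∀ z ∈ closedBall 0 1 \ S, 1 ≤ (G z).re)
    (hGS : ∀ z ∈ S, Tendsto (fun w => (G w).re) (𝓝[closedBall 0 1 \ S] z) atTop) :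
    ∃ F : ℂ → ℂ, DifferentiableOn ℂ F (ball 0 1) ∧ ContinuousOn F (closedBall 0 1 \ S) ∧
      (∀ z ∈ closedBall 0 1 \ S, 1 ≤ (F z).re ∧ 1 ≤ (F z ^ 2).re) ∧
      ∀ z ∈ S, Tendsto F (𝓝[closedBall 0 1 \ S] z) (Bornology.cobounded ℂ) := by
  have hslit : ∀ z ∈ closedBall 0 1 \ S, G z ∈ slitPlane := fun z hz =>
    Or.inl (one_pos.trans_le (hG1 z hz))
  have hball : ball (0 : ℂ) 1 ⊆ closedBall 0 1 \ S := ball_subset_closedBall_diff hS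
  have hsq : ∀ z, Complex.sqrt (G z) ^ 2 = G z := fun z => cpow_ofNat_inv_pow (G z) 2
  have hre : ∀ z, (Complex.sqrt (G z)).re = √((‖G z‖ + (G z).re) / 2) := fun z =>
    cpow_inv_two_re (G z)
  refine ⟨fun z => Complex.sqrt (G z),
    differentiableOn_sqrt.comp hGd fun z hz => hslit z (hball hz),
    continuousOn_sqrt.comp hGc hslit, fun z hz => ?_, fun z hz => ?_⟩
  · have hG := (hG1 z hz).trans_eq (congrArg re (hsq z).symm)
    exact ⟨one_le_re_of_one_le_re_sq ((hre z).symm ▸ Real.sqrt_nonneg _) hG, hG⟩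
  · refine tendsto_norm_atTop_iff_cobounded.1 (tendsto_atTop_mono (fun w => ?_)
      (Real.tendsto_sqrt_atTop.comp (hGS z hz)))
    calc √(G w).re ≤ √((‖G w‖ + (G w).re) / 2) :=
          Real.sqrt_le_sqrt (by linarith [re_le_norm (G w)])
      _ = (Complex.sqrt (G w)).re := (hre w).symm
      _ ≤ ‖Complex.sqrt (G w)‖ := re_le_norm _

theorem exists_memDiscAlgebra_eq_one_sub_inv {F : ℂ → ℂ} (hS : S ⊆ sphere 0 1)
    (hFd : DifferentiableOn ℂ F (ball 0 1)) (hFc : ContinuousOn F (closedBall 0 1 \ S))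
    (hF0 : ∀ z ∈ closedBall 0 1 \ S, F z ≠ 0)
    (hFS : ∀ z ∈ S, Tendsto F (𝓝[closedBall 0 1 \ S] z) (Bornology.cobounded ℂ)) :
    ∃ φ : ℂ → ℂ, MemDiscAlgebra φ ∧ (∀ z ∈ closedBall 0 1 \ S, φ z = 1 - (F z)⁻¹) ∧
      ∀ z ∈ S, φ z = 1 := by
  set D := closedBall (0 : ℂ) 1 \ S
  have hball : ball (0 : ℂ) 1 ⊆ D := ball_subset_closedBall_diff hS
  have hdense : closedBall (0 : ℂ) 1 ⊆ closure D := by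
    rw [← closure_ball 0 one_ne_zero]
    exact closure_mono hball
  let f : ℂ → ℂ := fun z => 1 - (F z)⁻¹
  have hfS : ∀ z ∈ S, Tendsto f (𝓝[D] z) (𝓝 1) := fun z hz => by
    simpa [f] using tendsto_const_nhds.sub (tendsto_inv₀_cobounded.comp (hFS z hz))
  have hfc : ContinuousOn f D := continuousOn_const.sub (hFc.inv₀ hF0)
  have hfD : ∀ z ∈ D, extendFrom D f z = f z := fun z hz =>
    extendFrom_eq (subset_closure hz) (hfc z hz)
  refine ⟨extendFrom D f, ⟨?_, continuousOn_extendFrom hdense fun z hz => ?_⟩, hfD,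
    fun z hz => extendFrom_eq (hdense (sphere_subset_closedBall (hS hz))) (hfS z hz)⟩
  · have hfd : DifferentiableOn ℂ f (ball 0 1) :=
      (hFd.inv fun z hz => hF0 z (hball hz)).const_sub 1
    exact hfd.congr fun z hz => hfD z (hball hz)
  · by_cases hzS : z ∈ S
    · exact ⟨1, hfS z hzS⟩
    · exact ⟨f z, hfc z ⟨hz, hzS⟩⟩

end Peak

theorem exists_memDiscAlgebra_harmonic_majorant {E : Set Circle} (hE : IsClosed E)
    (hE0 : arcLength E = 0) :
    ∃ (φ : ℂ → ℂ) (u : ℂ → ℝ), MemDiscAlgebra φ ∧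
      (∀ z ∈ closedBall 0 1 \ (↑) '' E, ‖φ z‖ < 1) ∧
      (∀ z ∈ ((↑) : Circle → ℂ) '' E, φ z = 1) ∧
      InnerProductSpace.HarmonicOnNhd u (ball 0 1) ∧
      ∀ z ∈ ball 0 1, (1 - ‖φ z‖ ^ 2)⁻¹ ≤ u z := by
  have hS : ((↑) : Circle → ℂ) '' E ⊆ sphere 0 1 := by
    rintro _ ⟨ζ, -, rfl⟩
    exact ζ.2
  have hball := ball_subset_closedBall_diff hS
  obtain ⟨G, hGd, hGc, hG1, hGE⟩ := exists_re_tendsto_atTop_of_arcLength_eq_zero hE hE0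
  obtain ⟨F, hFd, hFc, hF1, hFE⟩ := exists_sqrt_tendsto_cobounded hS hGd hGc hG1 hGE
  have hF0 : ∀ z ∈ closedBall 0 1 \ (↑) '' E, F z ≠ 0 := fun z hz h => by
    have hre := (hF1 z hz).1
    norm_num [h] at hre
  obtain ⟨φ, hφA, hφF, hφE⟩ := exists_memDiscAlgebra_eq_one_sub_inv hS hFd hFc hF0 hFE
  refine ⟨φ, fun z => (2 * F z).re, hφA, fun z hz => ?_, hφE, fun z hz => ?_, fun z hz => ?_⟩
  · rw [hφF z hz]
    exact norm_one_sub_inv_lt_one (hF1 z hz).1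
  · exact ((hFd.const_mul 2).analyticAt (isOpen_ball.mem_nhds hz)).harmonicAt_re
  · obtain ⟨hre, hre_sq⟩ := hF1 z (hball hz)
    rw [hφF z (hball hz)]
    simpa using inv_one_sub_norm_one_sub_inv_sq_le hre hre_sq

theorem mainTheorem3 (E : Set Circle) (hE : IsClosed E) (hE0 : arcLength E = 0) :
    ∃ φ : ℂ → ℂ, MemDiscAlgebra φ ∧
      ∃ hφ : ∀ z : UnitDisc, ‖φ (z : ℂ)‖ < 1,
        (∃ T : HardySpace →L[ℂ] HardySpace, IsCompositionOperator φ hφ T ∧ IsHilbertSchmidt T) ∧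
        levelSet φ 1 = E := by
  obtain ⟨φ, u, hφ, hφ_lt, hφ_one, hu, hφu⟩ := exists_memDiscAlgebra_harmonic_majorant hE hE0
  have hφ_lt_of_notMem : ∀ ζ : Circle, ζ ∉ E → ‖φ ζ‖ < 1 := fun ζ hζ =>
    hφ_lt ζ ⟨sphere_subset_closedBall ζ.2, fun ⟨_, hξ, h⟩ => hζ (Circle.coe_injective h ▸ hξ)⟩
  have hφ_disc : ∀ z : 𝔻, ‖φ z‖ < 1 := fun z =>
    hφ_lt z ⟨by simpa using z.norm_lt_one.le, fun ⟨ζ, _, h⟩ =>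
      z.norm_lt_one.ne (h ▸ Circle.norm_coe ζ)⟩
  refine ⟨φ, hφ, hφ_disc, exists_isHilbertSchmidt_compositionOperator hφ.1 hφ_disc hu hφu, ?_⟩
  ext ζ
  refine ⟨fun hζ => by_contra fun hζE => (hφ_lt_of_notMem ζ hζE).not_ge hζ, fun hζ => ?_⟩
  have hone : φ ζ = 1 := hφ_one ζ (mem_image_of_mem _ hζ)
  change 1 ≤ ‖φ ζ‖
  rw [hone, norm_one]
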